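/- Let $X\subset\mathbb R^p$ be a compact polyhedron, $c\in\mathbb R^p$, $W\in\mathbb R^{s\times d}$, and let $\xi=(\xi^1,\dots,\xi^m)$ have independent coordinates, each $\xi^k$ being a discrete real random variable with finite support $\Xi_k$ and distribution function $F_k$. Let $h=h(\xi)\in\mathbb R^s$, $q=q(\xi)\in\mathbb R^d$, $T=T(\xi)\in\mathbb R^{s\times p}$ be functions of $\xi$ (for example $\xi=(h,q,T)$), and put $$Q(x,\xi)=\inf\{q^Ty: Wy\le h-Tx,\ y\ge 0\}\in[-\infty,\infty],\qquad G(x,\xi)=c^Tx+Q(x,\xi),\qquad g(x)=\mathbb E[G(x,\xi)].$$ Let $F_k^{-1}(z)=\inf\{y\in\Xi_k: F_k(y)\ge z\}$, $\Psi(u)=(F_1^{-1}(u^1),\dots,F_m^{-1}(u^m))$ and $\tilde G(x,u)=G(x,\Psi(u))$ for $u\in(0,1]^m$. Suppose that $\mathbb E[\tilde G(x,\tilde\xi)^2]<\infty$ for every $x\in X$, where $\tilde\xi$ is uniform on $(0,1]^m$ (so $G(x,\cdot)$ is finite at all values taken by $\xi$ with positive probability), and that $\min_{x\in X} g(x)$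 has a unique optimal solution $x^*$. For an $n\times m$ matrix $D$ with rows $\tilde\xi_1,\dots,\tilde\xi_n\in(0,1]^m$ let $v_n(D)=\min_{x\in X}\frac1n\sum_{i=1}^n\tilde G(x,\tilde\xi_i)$. Fix $t\ge1$. For each $n\ge1$ let $D_{n,1},\dots,D_{n,t}$ be random $n\times m$ matrices, all defined on one probability space, such that one of the following holds: every $D_{n,r}$ is a Monte Carlo design (independent rows, uniform on $(0,1]^m$); or every $D_{n,r}$ is an ordinary Latin hypercube design, i.e. has entries $(a_{ik}-\gamma_{ik})/n$ where the columns of $(a_{ik})$ are independent uniform random permutations of $\{1,\dots,n\}$ and the $\gamma_{ik}$ are independent uniform on $[0,1)$ and independent of $(a_{ik})$; or $(D_{n,1},\dots,D_{n,t})$ is a sliced Latin hypercube design, i.e. has entries $(a_{r,ik}-\gamma_{r,ik})/(nt)$, where one starts from $t$ independent ordinary Latin hypercubes with levels $1,\dots,n$, replaces, independently for each column $k$ and level $\ell$, the $t$ occurrences of $\ell$ in the $k$th columns of the $t$ arrays by a uniform random permutation of $\{t(\ell-1)+1,\dots,t\ell\}$ to get $(a_{r,ik})$, and takes the $\gamma_{r,ik}$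 independent uniform on $[0,1)$ and independent of $(a_{r,ik})$. (In the first two cases the batches for the same $n$, and in all cases the batches for different $n$, may depend on each other arbitrarily.) Put $L_{n,t}=\frac1t\sum_{r=1}^t v_n(D_{n,r})$ and let $\tilde\xi_{n,r,i}$ be the $i$th row of $D_{n,r}$. Then, with probability $1$, there is a (random) $N$ such that for all $n\ge N$ $$L_{n,t}=\frac1{nt}\sum_{r=1}^t\sum_{i=1}^n\tilde G(x^*,\tilde\xi_{n,r,i}).$$ -/

import Mathlib

open MeasureTheory ProbabilityTheory Filter

noncomputable section

namespace SAA

/-! ### The two-stage stochastic linear program -/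

/-- Data of a two-stage stochastic linear program with fixed recourse: first-stage variable in
`ℝ^p`, second-stage variable in `ℝ^d`, `s` second-stage constraints, random vector `ξ ∈ ℝ^m`.
The right-hand side `h`, the second-stage cost `q` and the technology matrix `T` are read off
from `ξ`; the case `ξ = (h, q, T)` is the one where these maps are coordinate projections, and
entries that are not random are constant maps. The recourse matrix `W` does not depend on `ξ`. -/
structure TwoStageLP (m p s d : ℕ) where
  X : Set (Fin p → ℝ)
  c : Fin p → ℝ
  W : Matrix (Fin s) (Fin d) ℝ
  h : (Fin m → ℝ) → Fin s → ℝ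
  q : (Fin m → ℝ) → Fin d → ℝ
  T : (Fin m → ℝ) → Matrix (Fin s) (Fin p) ℝ

/-- A polyhedron: the solution set of finitely many linear inequalities. -/
def IsPolyhedron {p : ℕ} (X : Set (Fin p → ℝ)) : Prop :=
  ∃ (l : ℕ) (A : Matrix (Fin l) (Fin p) ℝ) (b : Fin l → ℝ), X = {x | A.mulVec x ≤ b}

namespace TwoStageLP

variable {m p s d : ℕ} (L : TwoStageLP m p s d)

/-- `Q(x, ξ) = inf {qᵀ y : W y ≤ h - T x, y ≥ 0}`, with values in `[-∞, ∞]`. -/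
def recourse (x : Fin p → ℝ) (ξ : Fin m → ℝ) : EReal :=
  ⨅ y ∈ {y : Fin d → ℝ | L.W.mulVec y ≤ L.h ξ - (L.T ξ).mulVec x ∧ 0 ≤ y},
    ((dotProduct (L.q ξ) y : ℝ) : EReal)

/-- `G(x, ξ) = cᵀ x + Q(x, ξ)`, with values in `[-∞, ∞]`. -/
def extCost (x : Fin p → ℝ) (ξ : Fin m → ℝ) : EReal :=
  ((dotProduct L.c x : ℝ) : EReal) + L.recourse x ξ

/-- `G(x, ξ)` as a real number (meaningful where `extCost` is finite). -/
def cost (x : Fin p → ℝ) (ξ : Fin m → ℝ) : ℝ :=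
  (L.extCost x ξ).toReal

/-- `g(x) = E[G(x, ξ)]`, where the coordinates of `ξ` are independent with laws `μ k`. -/
def objective (μ : Fin m → Measure ℝ) (x : Fin p → ℝ) : ℝ :=
  ∫ ξ, L.cost x ξ ∂(Measure.pi μ)

/-- `S*`: the set of optimal solutions of `min_{x ∈ X} g(x)`. -/
def optimalSet (μ : Fin m → Measure ℝ) : Set (Fin p → ℝ) :=
  {x | x ∈ L.X ∧ ∀ y ∈ L.X, L.objective μ x ≤ L.objective μ y}

end TwoStageLP

/-! ### Transformation to uniform variables -/

/-- `F⁻¹(z) = inf {y ∈ Ξ : F(y) ≥ z}`, with `F` the distribution function of `μ` and `Ξ` its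
support. -/
def quantile (μ : Measure ℝ) (z : ℝ) : ℝ :=
  sInf {y | y ∈ μ.support ∧ z ≤ cdf μ y}

/-- `Ψ(u) = (F₁⁻¹(u¹), …, F_m⁻¹(u^m))`. -/
def quantileMap {m : ℕ} (μ : Fin m → Measure ℝ) (u : Fin m → ℝ) : Fin m → ℝ :=
  fun k => quantile (μ k) (u k)

/-- The uniform distribution on `(0, 1]^m`. -/
def uniformCube (m : ℕ) : Measure (Fin m → ℝ) :=
  Measure.pi fun _ => volume.restrict (Set.Ioc (0 : ℝ) 1)

namespace TwoStageLP

variable {m p s d : ℕ} (L : TwoStageLP m p s d) (μ : Fin m → Measure ℝ)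

/-- `G̃(x, u) = G(x, Ψ(u))` on `(0, 1]^m`. -/
def costTilde (x : Fin p → ℝ) (u : Fin m → ℝ) : ℝ :=
  L.cost x (quantileMap μ u)

/-- `E[G̃(x, ξ̃)²] ∈ [0, ∞]`, for `ξ̃` uniform on `(0, 1]^m`. It is computed from the extended
value of `G`, so it is infinite as soon as `G̃(x, ξ̃) = ±∞` with positive probability. -/
def secondMoment (x : Fin p → ℝ) : ENNReal :=
  ∫⁻ u, (L.extCost x (quantileMap μ u)).abs ^ 2 ∂(uniformCube m)

/-- `v_n(D)`: the optimal value of the sample-average approximation whose scenarios are the rows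
of the `n × m` matrix `D`. -/
def saaValue {n : ℕ} (D : Fin n → Fin m → ℝ) : ℝ :=
  sInf ((fun x => (n : ℝ)⁻¹ * ∑ i, L.costTilde μ x (D i)) '' L.X)

/-- `L_{n,t} = (v_n(D_1) + ⋯ + v_n(D_t)) / t`. -/
def lowerBound {n t : ℕ} (D : Fin t → Fin n → Fin m → ℝ) : ℝ :=
  (∑ r, L.saaValue μ (D r)) / t

end TwoStageLP

/-! ### Sampling schemes -/

/-- Law of an `n × m` Monte Carlo design: the rows are independent and uniform on `(0, 1]^m`. -/
def monteCarloLaw (n m : ℕ) : Measure (Fin n → Fin m → ℝ) :=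
  Measure.pi fun _ => uniformCube m

/-- Law of an `n × m` ordinary Latin hypercube design `ξ_{ik} = (a_{ik} - γ_{ik}) / n`: the columns
of `(a_{ik})` are independent uniform permutations of `{1, …, n}`, the `γ_{ik}` are independent,
uniform on `[0, 1)` and independent of `(a_{ik})`. It is written as the equal-weight mixture over
all tuples `π` of column permutations of `Fin n = {0, …, n - 1}`, so that `a_{ik} = π k i + 1`. -/
def latinHypercubeLaw (n m : ℕ) : Measure (Fin n → Fin m → ℝ) :=
  (Fintype.card (Fin m → Equiv.Perm (Fin n)) : ENNReal)⁻¹ •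
    ∑ π : Fin m → Equiv.Perm (Fin n),
      (Measure.pi fun _ : Fin n => Measure.pi fun _ : Fin m =>
          volume.restrict (Set.Ico (0 : ℝ) 1)).map
        fun γ i k => (((π k i : ℕ) : ℝ) + 1 - γ i k) / n

/-- Joint law of the `t` batches of a sliced Latin hypercube design. Take `t` independent ordinary
Latin hypercubes (permutations `A r k` of `Fin n`); for every column `k` and level `ℓ`, replace the
`t` occurrences of `ℓ` in the `k`-th columns by an independent uniform permutation (`σ k ℓ`, the
batch `r` receiving `σ k ℓ r`) of the block `{t(ℓ-1)+1, …, tℓ}`; then subtract independent uniform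
variables on `[0, 1)` and divide by `n t`. Again an equal-weight mixture; levels start at `0`. -/
def slicedLatinHypercubeLaw (n t m : ℕ) : Measure (Fin t → Fin n → Fin m → ℝ) :=
  (Fintype.card ((Fin t → Fin m → Equiv.Perm (Fin n)) ×
      (Fin m → Fin n → Equiv.Perm (Fin t))) : ENNReal)⁻¹ •
    ∑ Aσ : (Fin t → Fin m → Equiv.Perm (Fin n)) × (Fin m → Fin n → Equiv.Perm (Fin t)),
      (Measure.pi fun _ : Fin t => Measure.pi fun _ : Fin n => Measure.pi fun _ : Fin m =>
          volume.restrict (Set.Ico (0 : ℝ) 1)).map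
        fun γ r i k =>
          ((t : ℝ) * ((Aσ.1 r k i : ℕ) : ℝ) + ((Aσ.2 k (Aσ.1 r k i) r : ℕ) : ℝ) + 1 - γ r i k)
            / ((n : ℝ) * t)

/-- The batches `D_1, …, D_t` (random `n × m` matrices) come from one of the sampling schemes:
every batch is a Monte Carlo design, or every batch is an ordinary Latin hypercube design, or the
batches form a sliced Latin hypercube design. In the first two cases the batches may depend on each
other in any way; independent batches (as in independent Latin hypercube sampling) are a special
case. -/
def IsSampling {Ω : Type*} [MeasurableSpace Ω] (P : Measure Ω) {n t m : ℕ}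
    (D : Ω → Fin t → Fin n → Fin m → ℝ) : Prop :=
  (∀ r, HasLaw (fun ω => D ω r) (monteCarloLaw n m) P) ∨
  (∀ r, HasLaw (fun ω => D ω r) (latinHypercubeLaw n m) P) ∨
  HasLaw D (slicedLatinHypercubeLaw n t m) P

end SAA

end

/-! After grouping rows by scenario, the sample-average objective is `∑ ξ, freq ξ * cost x ξ`, a
nonnegative combination of finitely many functions, and the true objective is the same expression
with `prob ξ` as weights. Two facts then suffice.

Deterministic: a finite set `V ⊆ X`, independent of the weights, contains a point at least as good
as any given point of `X` (`exists_finite_minimizing_set`). The first-stage decision and one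
recourse decision per scenario form a polyhedron without lines, over which a linear functional is
minimized; one feasible point per realizable set of active constraints is enough
(`exists_finite_minimizers`).

Probabilistic: almost surely all frequencies converge to the probabilities (`ae_tendsto_freq`). In
every scheme, rows falling in the box of a scenario are negatively dependent up to an error `2 / n`
in the side lengths (`BoxDominated`). This gives a Chernoff bound, summable in `n`, so
Borel–Cantelli applies whatever the dependence between different `n`.

By uniqueness, `xstar` strictly beats every other point of the finite set `V` in the limit, hence
eventually also in the sample, hence it is optimal over `X` (`eventually_optimal`). Averaging over
the `t` batches gives the claim. -/

namespace SAA

/-! ### Minimizing linear functionals over polyhedra without lines. -/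

section Polyhedron

variable {E ι : Type*} [AddCommGroup E] [Module ℝ E] [Fintype ι]

/-- Moving from a point of a polyhedron along a direction that keeps the active constraints and
eventually leaves the polyhedron activates a new constraint. -/
theorem exists_more_active (a : ι → E →ₗ[ℝ] ℝ) (b : ι → ℝ) (f : E →ₗ[ℝ] ℝ) {z δ : E}
    (hz : ∀ i, a i z ≤ b i) (hact : ∀ i, a i z = b i → a i δ = 0) (hpos : ∃ i, 0 < a i δ)
    (hf : f δ ≤ 0) :
    ∃ z', (∀ i, a i z' ≤ b i) ∧ f z' ≤ f z ∧ (∀ i, a i z = b i → a i z' = b i) ∧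
      ∃ i, a i z ≠ b i ∧ a i z' = b i := by
  classical
  obtain ⟨j, hj⟩ := hpos
  obtain ⟨i, hi, hmin⟩ := Finset.exists_min_image (Finset.univ.filter fun i => 0 < a i δ)
    (fun i => (b i - a i z) / a i δ) ⟨j, by simpa using hj⟩
  replace hi : 0 < a i δ := by simpa using hi
  -- Ratio test: `τ` is the longest feasible step along `δ`, and the constraint `i` blocks it.
  set τ := (b i - a i z) / a i δ with hτ
  have hτ0 : 0 ≤ τ := div_nonneg (sub_nonneg.2 (hz i)) hi.le
  refine ⟨z + τ • δ, fun k => ?_, ?_, fun k hk => ?_, i, fun h => ?_, ?_⟩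
  · simp only [map_add, map_smul, smul_eq_mul]
    rcases le_or_gt (a k δ) 0 with hk | hk
    · nlinarith [hz k, mul_nonneg hτ0 (neg_nonneg.2 hk)]
    · have := hmin k (by simpa using hk)
      rw [le_div_iff₀ hk] at this
      linarith
  · simp only [map_add, map_smul, smul_eq_mul]
    nlinarith [mul_nonneg hτ0 (neg_nonneg.2 hf)]
  · simp [hact k hk, hk]
  · exact hi.ne' (hact i h)
  · simp only [map_add, map_smul, smul_eq_mul, hτ]
    field_simp
    ring

/-- A polyhedron without lines has a finite subset on which every linear functional that is
nonnegative on the recession cone attains its minimum. -/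
theorem exists_finite_minimizers (a : ι → E →ₗ[ℝ] ℝ) (b : ι → ℝ)
    (hline : ∀ δ, (∀ i, a i δ = 0) → δ = 0) :
    ∃ V : Set E, V.Finite ∧ (∀ v ∈ V, ∀ i, a i v ≤ b i) ∧
      ∀ f : E →ₗ[ℝ] ℝ, (∀ δ, (∀ i, a i δ ≤ 0) → 0 ≤ f δ) →
        ∀ z, (∀ i, a i z ≤ b i) → ∃ v ∈ V, f v ≤ f z := by
  classical
  let act : E → Finset ι := fun z => Finset.univ.filter fun i => a i z = b i
  -- One representative for each active set that occurs; the representatives need not be vertices.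
  let S := {I : Finset ι // ∃ z, (∀ i, a i z ≤ b i) ∧ act z = I}
  let pt : S → E := fun I => I.2.choose
  have hpt : ∀ I : S, (∀ i, a i (pt I) ≤ b i) ∧ act (pt I) = I.1 := fun I => I.2.choose_spec
  refine ⟨Set.range pt, Set.finite_range _, ?_, fun f hf => ?_⟩
  · rintro _ ⟨I, rfl⟩
    exact (hpt I).1
  -- Induction on the number of inactive constraints.
  suffices H : ∀ k z, (∀ i, a i z ≤ b i) → (act z)ᶜ.card = k → ∃ v ∈ Set.range pt, f v ≤ f z from
    fun z hz => H _ z hz rfl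
  intro k
  induction k using Nat.strong_induction_on with
  | _ k ih =>
    intro z hz hk
    let I : S := ⟨act z, z, hz, rfl⟩
    by_cases hv : pt I = z
    · exact ⟨pt I, ⟨I, rfl⟩, by rw [hv]⟩
    have step : ∀ δ, (∀ i, a i z = b i → a i δ = 0) → (∃ i, 0 < a i δ) → f δ ≤ 0 →
        ∃ v ∈ Set.range pt, f v ≤ f z := by
      intro δ h1 h2 h3
      obtain ⟨z', hz', hfz, hsub, i, hi, hi'⟩ := exists_more_active a b f hz h1 h2 h3
      have hlt : (act z')ᶜ.card < k := by
        rw [← hk]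
        refine Finset.card_lt_card (Finset.compl_ssubset_compl.2 ?_)
        refine (Finset.ssubset_iff_of_subset fun i hi => ?_).2 ⟨i, ?_, ?_⟩
        · simp only [act, Finset.mem_filter, Finset.mem_univ, true_and] at hi ⊢
          exact hsub i hi
        · simpa [act] using hi'
        · simpa [act] using hi
      obtain ⟨v, hv, hle⟩ := ih _ hlt z' hz' rfl
      exact ⟨v, hv, hle.trans hfz⟩
    -- `z` and its representative have the same active constraints, so both directions along `pt I -
    -- z` keep them active.
    have hδ : ∀ i, a i z = b i → a i (pt I - z) = 0 := by
      intro i hi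
      have : i ∈ act (pt I) := by
        rw [(hpt I).2]
        simpa [I, act] using hi
      rw [map_sub, hi, (Finset.mem_filter.1 this).2, sub_self]
    set δ := pt I - z with hδdef
    have hδ' : ∀ i, a i z = b i → a i (-δ) = 0 := fun i hi => by rw [map_neg, hδ i hi, neg_zero]
    -- If no step helps, a direction along which `f` does not increase is a recession direction,
    -- where `f` is nonnegative. So `f δ = 0`, and `δ` and `-δ` are both recession directions: a
    -- line, forcing `δ = 0`.
    by_contra hno
    have h1 : f δ ≤ 0 → ∀ i, a i δ ≤ 0 := fun h i => by
      by_contra hi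
      exact hno (step δ hδ ⟨i, not_le.1 hi⟩ h)
    have h2 : f (-δ) ≤ 0 → ∀ i, a i (-δ) ≤ 0 := fun h i => by
      by_contra hi
      exact hno (step (-δ) hδ' ⟨i, not_le.1 hi⟩ h)
    rcases le_or_gt (f δ) 0 with h | h
    · have h3 := hf δ (h1 h)
      have h4 := h2 (by rw [map_neg]; linarith)
      refine hv (sub_eq_zero.1 (hline δ fun i => le_antisymm (h1 h i) ?_))
      have := h4 i
      rw [map_neg] at this
      linarith
    · have h3 := h2 (by rw [map_neg]; linarith)
      have := hf _ h3
      rw [map_neg] at this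
      linarith

end Polyhedron

/-! ### Negative dependence for uniform permutations. -/

section Counting

/-- At most the fraction `(|J| / |α|) ^ |A|` of all permutations of `α` maps `A` into `J`. -/
theorem card_perm_mapsTo_le {α : Type*} [Fintype α] [DecidableEq α] (J A : Finset α) :
    (Finset.univ.filter fun π : Equiv.Perm α => ∀ i ∈ A, π i ∈ J).card * Fintype.card α ^ A.card ≤
      J.card ^ A.card * Fintype.card (Equiv.Perm α) := by
  induction A using Finset.induction_on with
  | empty => simp
  | insert a A ha ih =>
    set c : Finset α → ℕ := fun B =>
      (Finset.univ.filter fun π : Equiv.Perm α => ∀ i ∈ B, π i ∈ J).card with hc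
    -- Double counting of pairs `(π, b)`: each bijection `π` sends exactly `J.card` points `b` into
    -- `J`.
    have hsum : ∑ b, c (insert b A) = J.card * c A := by
      have : ∀ b, c (insert b A) = ∑ π ∈ Finset.univ.filter
          (fun π : Equiv.Perm α => ∀ i ∈ A, π i ∈ J), if π b ∈ J then 1 else 0 := by
        intro b
        rw [← Finset.sum_filter, Finset.filter_filter, Finset.sum_const, smul_eq_mul, mul_one]
        simp only [hc, Finset.forall_mem_insert, and_comm]
      simp_rw [this]
      rw [Finset.sum_comm]
      have h2 : ∀ π : Equiv.Perm α, (∑ b, if π b ∈ J then 1 else 0) = J.card := by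
        intro π
        rw [Equiv.sum_comp π (fun b => if b ∈ J then 1 else 0)]
        simp
      simp_rw [h2]
      simp [hc, mul_comm]
    have hle : ∀ b, c (insert a A) ≤ c (insert b A) := by
      intro b
      by_cases hb : b ∈ A
      · rw [Finset.insert_eq_of_mem hb]
        refine Finset.card_le_card fun π hπ => ?_
        simp only [Finset.mem_filter, Finset.mem_univ, true_and] at hπ ⊢
        exact fun i hi => hπ i (Finset.mem_insert_of_mem hi)
      -- Precomposing with the swap of `a` and `b` fixes `A` pointwise, so the count does not depend
      -- on the new point.
      · refine Finset.card_le_card_of_injOn (fun π => Equiv.swap a b * 1 |>.trans π) ?_ ?_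
        · intro π hπ
          simp only [Finset.coe_filter, Finset.mem_univ, true_and, Set.mem_ofPred_eq,
            Finset.forall_mem_insert] at hπ ⊢
          refine ⟨by simpa using hπ.1, fun i hi => ?_⟩
          have h1 : i ≠ a := fun h => ha (h ▸ hi)
          have h2 : i ≠ b := fun h => hb (h ▸ hi)
          simpa [Equiv.swap_apply_of_ne_of_ne h1 h2] using hπ.2 i hi
        · intro π _ ρ _ h
          ext i
          have := congrArg (fun e : Equiv.Perm α => e (Equiv.swap a b i)) h
          simpa using this
    have hn : Fintype.card α * c (insert a A) ≤ J.card * c A := by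
      rw [← hsum]
      simpa using Finset.card_nsmul_le_sum Finset.univ (fun b => c (insert b A)) _ fun b _ => hle b
    rw [Finset.card_insert_of_notMem ha]
    calc c (insert a A) * Fintype.card α ^ (A.card + 1)
        = Fintype.card α * c (insert a A) * Fintype.card α ^ A.card := by ring
      _ ≤ J.card * c A * Fintype.card α ^ A.card := by gcongr
      _ = J.card * (c A * Fintype.card α ^ A.card) := by ring
      _ ≤ J.card * (J.card ^ A.card * Fintype.card (Equiv.Perm α)) := by gcongr
      _ = _ := by ring

end Counting

end SAA

/-! ### The stochastic program as one linear program over finitely many scenarios. -/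

namespace SAA

namespace TwoStageLP

variable {m p s d : ℕ} (L : TwoStageLP m p s d)

/-- `y` is feasible for the second-stage problem. -/
def Feasible (x : Fin p → ℝ) (ξ : Fin m → ℝ) (y : Fin d → ℝ) : Prop :=
  L.W.mulVec y ≤ L.h ξ - (L.T ξ).mulVec x ∧ 0 ≤ y

variable {L} {x : Fin p → ℝ} {ξ : Fin m → ℝ}

theorem recourse_eq_coe (hbot : L.extCost x ξ ≠ ⊥) (htop : L.extCost x ξ ≠ ⊤) :
    L.recourse x ξ = ((L.cost x ξ - dotProduct L.c x : ℝ) : EReal) := by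
  unfold cost
  unfold extCost at hbot htop ⊢
  induction h : L.recourse x ξ with
  | bot => simp [h] at hbot
  | top => simp [h] at htop
  | coe r => rw [← EReal.coe_add, EReal.toReal_coe, add_sub_cancel_left]

theorem cost_le (hbot : L.extCost x ξ ≠ ⊥) (htop : L.extCost x ξ ≠ ⊤) {y : Fin d → ℝ}
    (hy : L.Feasible x ξ y) : L.cost x ξ ≤ dotProduct L.c x + dotProduct (L.q ξ) y := by
  have h : L.recourse x ξ ≤ ((dotProduct (L.q ξ) y : ℝ) : EReal) := iInf₂_le y hy
  rw [recourse_eq_coe hbot htop, EReal.coe_le_coe_iff] at h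
  linarith

theorem exists_feasible_lt (hbot : L.extCost x ξ ≠ ⊥) (htop : L.extCost x ξ ≠ ⊤) {ε : ℝ}
    (hε : 0 < ε) : ∃ y, L.Feasible x ξ y ∧
      dotProduct L.c x + dotProduct (L.q ξ) y < L.cost x ξ + ε := by
  have h : L.recourse x ξ < ((L.cost x ξ - dotProduct L.c x + ε : ℝ) : EReal) := by
    rw [recourse_eq_coe hbot htop, EReal.coe_lt_coe_iff]
    linarith
  unfold recourse at h
  simp only [iInf_lt_iff, EReal.coe_lt_coe_iff] at h
  obtain ⟨y, hy, hlt⟩ := h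
  exact ⟨y, hy, by linarith⟩

/-- Otherwise moving from a feasible point along `y` would drive the cost to `-∞`, against its
finiteness. -/
theorem dotProduct_nonneg_of_recession (hbot : L.extCost x ξ ≠ ⊥) (htop : L.extCost x ξ ≠ ⊤)
    {y : Fin d → ℝ} (hW : L.W.mulVec y ≤ 0) (hy : 0 ≤ y) : 0 ≤ dotProduct (L.q ξ) y := by
  obtain ⟨y₀, hy₀, -⟩ := exists_feasible_lt hbot htop one_pos
  by_contra! hneg
  have key : ∀ τ : ℝ, 0 ≤ τ →
      L.cost x ξ ≤ dotProduct L.c x + (dotProduct (L.q ξ) y₀ + τ * dotProduct (L.q ξ) y) := by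
    intro τ hτ
    have hf : L.Feasible x ξ (y₀ + τ • y) := by
      refine ⟨?_, add_nonneg hy₀.2 (smul_nonneg hτ hy)⟩
      rw [Matrix.mulVec_add, Matrix.mulVec_smul]
      exact (add_le_add hy₀.1 (smul_nonpos_of_nonneg_of_nonpos hτ hW)).trans (by simp)
    simpa [dotProduct_add, dotProduct_smul] using cost_le hbot htop hf
  have h0 := key 0 le_rfl
  -- This `τ` makes the right-hand side of `key` equal to `L.cost x ξ - 1`.
  have h1 := key ((L.cost x ξ - dotProduct L.c x - dotProduct (L.q ξ) y₀ - 1) /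
    dotProduct (L.q ξ) y) (div_nonneg_of_nonpos (by linarith) hneg.le)
  rw [div_mul_cancel₀ _ hneg.ne] at h1
  linarith

end TwoStageLP

/-- A nonempty bounded polyhedron has trivial recession cone. -/
theorem eq_zero_of_mulVec_nonpos {l p : ℕ} {A : Matrix (Fin l) (Fin p) ℝ} {b : Fin l → ℝ}
    (hb : Bornology.IsBounded {x | A.mulVec x ≤ b}) {x δ : Fin p → ℝ} (hx : A.mulVec x ≤ b)
    (hδ : A.mulVec δ ≤ 0) : δ = 0 := by
  obtain ⟨R, hR⟩ := hb.exists_norm_le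
  by_contra h
  have hpos : 0 < ‖δ‖ := norm_pos_iff.2 h
  set τ := (R + ‖x‖ + 1) / ‖δ‖ with hτ
  have hR0 : 0 ≤ R := (norm_nonneg x).trans (hR x hx)
  have hτ0 : 0 ≤ τ := by positivity
  have h1 : ‖x + τ • δ‖ ≤ R := hR _ <| by
    change A.mulVec (x + τ • δ) ≤ b
    rw [Matrix.mulVec_add, Matrix.mulVec_smul]
    exact (add_le_add hx (smul_nonpos_of_nonneg_of_nonpos hτ0 hδ)).trans (by simp)
  have h2 : ‖τ • δ‖ ≤ ‖x + τ • δ‖ + ‖x‖ := by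
    simpa using norm_sub_le (x + τ • δ) x
  rw [norm_smul, Real.norm_of_nonneg hτ0, hτ, div_mul_cancel₀ _ hpos.ne'] at h2
  linarith

namespace TwoStageLP

variable {m p s d : ℕ} {L : TwoStageLP m p s d}

/-- Finitely many first-stage decisions suffice to minimize every nonnegative combination of
finitely many scenario costs. -/
theorem exists_finite_minimizing_set (hXcompact : IsCompact L.X) (hXpoly : IsPolyhedron L.X)
    (hXne : L.X.Nonempty) (S : Finset (Fin m → ℝ))
    (hbot : ∀ x ∈ L.X, ∀ ξ ∈ S, L.extCost x ξ ≠ ⊥) (htop : ∀ x ∈ L.X, ∀ ξ ∈ S, L.extCost x ξ ≠ ⊤) :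
    ∃ V : Set (Fin p → ℝ), V.Finite ∧ V ⊆ L.X ∧ ∀ w : (Fin m → ℝ) → ℝ, (∀ ξ, 0 ≤ w ξ) →
      ∀ x ∈ L.X, ∃ v ∈ V, ∑ ξ ∈ S, w ξ * L.cost v ξ ≤ ∑ ξ ∈ S, w ξ * L.cost x ξ := by
  classical
  obtain ⟨l, A, b, hX⟩ := hXpoly
  obtain ⟨x₀, hx₀⟩ := hXne
  have hbdd : Bornology.IsBounded {x | A.mulVec x ≤ b} := hX ▸ hXcompact.isBounded
  have hmem : ∀ x, x ∈ L.X ↔ A.mulVec x ≤ b := fun x => by rw [hX]; rfl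
  -- The deterministic equivalent: a first-stage decision with one recourse decision per scenario.
  let E := (Fin p → ℝ) × (S → Fin d → ℝ)
  let a : Fin l ⊕ (S × (Fin s ⊕ Fin d)) → E →ₗ[ℝ] ℝ
    | .inl j => LinearMap.proj j ∘ₗ A.mulVecLin ∘ₗ LinearMap.fst ℝ _ _
    | .inr (ξ, .inl i) => LinearMap.proj i ∘ₗ
        (L.W.mulVecLin ∘ₗ LinearMap.proj ξ ∘ₗ LinearMap.snd ℝ _ _ +
          (L.T ξ).mulVecLin ∘ₗ LinearMap.fst ℝ _ _)
    | .inr (ξ, .inr k) => -((LinearMap.proj k : (Fin d → ℝ) →ₗ[ℝ] ℝ) ∘ₗ LinearMap.proj ξ ∘ₗ LinearMap.snd ℝ _ _)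
  let b' : Fin l ⊕ (S × (Fin s ⊕ Fin d)) → ℝ
    | .inl j => b j
    | .inr (ξ, .inl i) => L.h ξ i
    | .inr (_, .inr _) => 0
  have hP : ∀ z : E, (∀ i, a i z ≤ b' i) ↔
      z.1 ∈ L.X ∧ ∀ ξ : S, L.Feasible z.1 ξ (z.2 ξ) := by
    intro z
    simp only [Sum.forall, Prod.forall, hmem, Feasible, Pi.le_def]
    refine and_congr Iff.rfl (forall_congr' fun ξ => and_congr (forall_congr' fun i => ?_)
      (forall_congr' fun k => ?_))
    · exact le_sub_iff_add_le.symm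
    · exact neg_nonpos
  have hcone : ∀ δ : E, (∀ i, a i δ ≤ 0) →
      δ.1 = 0 ∧ ∀ ξ : S, L.W.mulVec (δ.2 ξ) ≤ 0 ∧ 0 ≤ δ.2 ξ := by
    intro δ h
    simp only [Sum.forall, Prod.forall] at h
    have h1 : δ.1 = 0 := eq_zero_of_mulVec_nonpos hbdd ((hmem x₀).1 hx₀) fun j => h.1 j
    refine ⟨h1, fun ξ => ⟨fun i => ?_, fun k => neg_nonpos.1 ((h.2 ξ).2 k)⟩⟩
    have : L.W.mulVec (δ.2 ξ) i + (L.T ξ).mulVec δ.1 i ≤ 0 := (h.2 ξ).1 i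
    simpa [h1] using this
  -- There is no line: boundedness of `L.X` kills the first component, and nonnegativity in both
  -- directions kills the recourse components.
  obtain ⟨V, hVfin, hVP, hV⟩ := exists_finite_minimizers a b' fun δ hδ => by
    have h1 := hcone δ fun i => (hδ i).le
    have h2 := hcone (-δ) fun i => by rw [map_neg, hδ i, neg_zero]
    refine Prod.ext h1.1 (funext fun ξ => le_antisymm ?_ (h1.2 ξ).2)
    exact neg_nonneg.1 (h2.2 ξ).2
  refine ⟨Prod.fst '' V, hVfin.image _, ?_, fun w hw x hx => ?_⟩
  · rintro _ ⟨v, hv, rfl⟩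
    exact ((hP v).1 (hVP v hv)).1
  let f : E →ₗ[ℝ] ℝ := ∑ ξ : S, w ξ •
    (dotProductBilin ℝ ℝ L.c ∘ₗ LinearMap.fst ℝ _ _ +
      dotProductBilin ℝ ℝ (L.q ξ) ∘ₗ LinearMap.proj ξ ∘ₗ LinearMap.snd ℝ _ _)
  have hf : ∀ z : E, f z = ∑ ξ : S, w ξ * (dotProduct L.c z.1 + dotProduct (L.q ξ) (z.2 ξ)) := by
    intro z
    rw [LinearMap.sum_apply]
    rfl
  by_contra! hcon
  -- Only `ε`-optimal recourse is used, so attainment of the second-stage infimum is not needed;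
  -- finiteness of `V` leaves room for a uniform `ε`.
  obtain ⟨ε, hε, hlt⟩ : ∃ ε > 0, ∀ v ∈ Prod.fst '' V,
      ∑ ξ ∈ S, w ξ * L.cost x ξ + ε * ∑ ξ ∈ S, w ξ < ∑ ξ ∈ S, w ξ * L.cost v ξ := by
    have hev : ∀ᶠ ε : ℝ in nhdsWithin 0 (Set.Ioi 0), ∀ v ∈ Prod.fst '' V,
        ∑ ξ ∈ S, w ξ * L.cost x ξ + ε * ∑ ξ ∈ S, w ξ < ∑ ξ ∈ S, w ξ * L.cost v ξ := by
      refine ((hVfin.image _).eventually_all).2 fun v hv => ?_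
      have hc : Continuous fun ε : ℝ => ∑ ξ ∈ S, w ξ * L.cost x ξ + ε * ∑ ξ ∈ S, w ξ := by
        fun_prop
      exact (hc.tendsto' 0 _ (by simp)).mono_left nhdsWithin_le_nhds |>.eventually_lt_const
        (hcon v hv)
    obtain ⟨ε, h1, h2⟩ := (hev.and self_mem_nhdsWithin).exists
    exact ⟨ε, h2, h1⟩
  choose y hy hylt using fun ξ : S =>
    exists_feasible_lt (hbot x hx ξ ξ.2) (htop x hx ξ ξ.2) hε
  obtain ⟨v, hv, hle⟩ := hV f (fun δ hδ => by
    obtain ⟨h1, h2⟩ := hcone δ hδ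
    rw [hf]
    refine Finset.sum_nonneg fun ξ _ => mul_nonneg (hw ξ) ?_
    rw [h1, dotProduct_zero, zero_add]
    exact dotProduct_nonneg_of_recession (hbot x hx ξ ξ.2) (htop x hx ξ ξ.2) (h2 ξ).1 (h2 ξ).2)
    (x, y) ((hP _).2 ⟨hx, hy⟩)
  obtain ⟨hv1, hv2⟩ := (hP v).1 (hVP v hv)
  have h1 : ∑ ξ ∈ S, w ξ * L.cost v.1 ξ ≤ f v := by
    rw [hf, ← Finset.sum_coe_sort S]
    exact Finset.sum_le_sum fun ξ _ => mul_le_mul_of_nonneg_left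
      (cost_le (hbot _ hv1 ξ ξ.2) (htop _ hv1 ξ ξ.2) (hv2 ξ)) (hw ξ)
  have h2 : f (x, y) ≤ ∑ ξ ∈ S, w ξ * L.cost x ξ + ε * ∑ ξ ∈ S, w ξ := by
    rw [hf, Finset.mul_sum, ← Finset.sum_add_distrib, ← Finset.sum_coe_sort S]
    refine Finset.sum_le_sum fun ξ _ => ?_
    nlinarith [hw ξ, hylt ξ]
  exact absurd (hlt v.1 ⟨v, hv, rfl⟩) (not_lt.2 ((h1.trans hle).trans h2))

end TwoStageLP

end SAA

/-! ### Scenarios as boxes in the unit cube. -/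

namespace SAA

section Quantile

variable {ν : Measure ℝ}

/-- A point of a finite support is isolated in it, so removing the other support points leaves a
neighbourhood whose mass is all at `y`. -/
theorem measure_singleton_pos_of_mem_support (hfin : ν.support.Finite) {y : ℝ}
    (hy : y ∈ ν.support) : 0 < ν {y} := by
  have hU : (ν.support \ {y})ᶜ ∈ nhds y :=
    (hfin.subset Set.sdiff_subset).isClosed.isOpen_compl.mem_nhds (by simp)
  have h1 := (Measure.mem_support_iff_forall y).1 hy _ hU
  refine h1.trans_le ?_
  calc ν (ν.support \ {y})ᶜ ≤ ν ({y} ∪ ν.supportᶜ) := measure_mono fun z hz => by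
        by_cases h : z = y
        · simp [h]
        · exact Or.inr fun hz' => hz ⟨hz', h⟩
    _ ≤ ν {y} + ν ν.supportᶜ := measure_union_le _ _
    _ = ν {y} := by rw [Measure.measure_compl_support, add_zero]

variable [IsProbabilityMeasure ν]

theorem quantile_eq_of_mem_Ioc {y z : ℝ} (hy : y ∈ ν.support)
    (hz : z ∈ Set.Ioc (ν.real (Set.Iio y)) (ν.real (Set.Iic y))) : quantile ν z = y := by
  refine IsLeast.csInf_eq ⟨⟨hy, by rw [cdf_eq_real]; exact hz.2⟩, fun y' hy' => ?_⟩
  by_contra! hlt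
  have h1 := hy'.2
  rw [cdf_eq_real] at h1
  have h2 : ν.real (Set.Iic y') ≤ ν.real (Set.Iio y) :=
    measureReal_mono (Set.Iic_subset_Iio.2 hlt)
  linarith [hz.1]

/-- Take the least support point `y` whose cdf value is at least `z`. If the mass strictly below `y`
were already at least `z`, the largest support point below `y` would qualify too. -/
theorem exists_mem_support_mem_Ioc (hfin : ν.support.Finite) {z : ℝ}
    (hz : z ∈ Set.Ioc (0 : ℝ) 1) :
    ∃ y ∈ ν.support, z ∈ Set.Ioc (ν.real (Set.Iio y)) (ν.real (Set.Iic y)) := by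
  have hne : ν.support.Nonempty := Measure.nonempty_support (IsProbabilityMeasure.ne_zero ν)
  have hIic : ∀ (s : Set ℝ) (M : ℝ), (∀ y ∈ ν.support, y ∈ s → y ≤ M) →
      ν.real s ≤ ν.real (Set.Iic M) := by
    intro s M hM
    refine ENNReal.toReal_mono (measure_ne_top _ _) (measure_mono_ae ?_)
    filter_upwards [Measure.support_mem_ae (μ := ν)] with y hy hys using hM y hy hys
  set S := {y | y ∈ ν.support ∧ z ≤ ν.real (Set.Iic y)} with hS
  have hSfin : S.Finite := hfin.subset fun y hy => hy.1
  have hSne : S.Nonempty := by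
    obtain ⟨M, hM, hmax⟩ := Set.exists_max_image _ id hfin hne
    refine ⟨M, hM, hz.2.trans ?_⟩
    have := hIic Set.univ M fun y hy _ => hmax y hy
    simpa using this
  obtain ⟨y, hy, hmin⟩ := Set.exists_min_image S id hSfin hSne
  refine ⟨y, hy.1, ?_, hy.2⟩
  by_contra! hle
  have hne' : (Set.Iio y ∩ ν.support).Nonempty := by
    refine Measure.nonempty_inter_support_of_pos ?_
    have : 0 < ν.real (Set.Iio y) := hz.1.trans_le hle
    exact (ENNReal.toReal_pos_iff.1 this).1
  obtain ⟨M, hM, hmax⟩ := Set.exists_max_image _ id (hfin.subset Set.inter_subset_right) hne'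
  have h1 := hIic (Set.Iio y) M fun y' hy' hlt => hmax y' ⟨hlt, hy'⟩
  have h2 : y ≤ M := hmin M ⟨hM.2, hle.trans h1⟩
  exact absurd hM.1 (not_lt.2 h2)

theorem measureReal_Iic_sub_Iio (y : ℝ) :
    ν.real (Set.Iic y) - ν.real (Set.Iio y) = ν.real {y} := by
  rw [← Set.Iio_union_right, measureReal_union (by simp) (measurableSet_singleton y)]
  ring

end Quantile

variable {m : ℕ} (μ : Fin m → Measure ℝ)

/-- The box of all `u` that `quantileMap` sends to `ξ`. -/
def box (ξ : Fin m → ℝ) : Set (Fin m → ℝ) :=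
  Set.univ.pi fun k => Set.Ioc ((μ k).real (Set.Iio (ξ k))) ((μ k).real (Set.Iic (ξ k)))

/-- The finitely many values taken with positive probability. -/
noncomputable def scenarios (hfin : ∀ k, (μ k).support.Finite) : Finset (Fin m → ℝ) :=
  Fintype.piFinset fun k => (hfin k).toFinset

/-- The probability of the scenario `ξ`. -/
noncomputable def prob (ξ : Fin m → ℝ) : ℝ := ∏ k, (μ k).real {ξ k}

variable {μ} {hfin : ∀ k, (μ k).support.Finite}

theorem mem_scenarios {ξ : Fin m → ℝ} : ξ ∈ scenarios μ hfin ↔ ∀ k, ξ k ∈ (μ k).support := by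
  simp [scenarios]

theorem measurableSet_box (ξ : Fin m → ℝ) : MeasurableSet (box μ ξ) :=
  MeasurableSet.univ_pi fun _ => measurableSet_Ioc

variable [hprob : ∀ k, IsProbabilityMeasure (μ k)]

theorem quantileMap_eq_of_mem_box {ξ u : Fin m → ℝ} (hξ : ξ ∈ scenarios μ hfin)
    (hu : u ∈ box μ ξ) : quantileMap μ u = ξ :=
  funext fun k => quantile_eq_of_mem_Ioc (mem_scenarios.1 hξ k) (hu k trivial)

theorem quantileMap_mem {u : Fin m → ℝ} (hu : ∀ k, u k ∈ Set.Ioc (0 : ℝ) 1) :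
    quantileMap μ u ∈ scenarios μ hfin ∧ u ∈ box μ (quantileMap μ u) := by
  choose y hy hmem using fun k => exists_mem_support_mem_Ioc (hfin k) (hu k)
  have hbox : u ∈ box μ y := fun k _ => hmem k
  have hys : y ∈ scenarios μ hfin := mem_scenarios.2 hy
  rw [quantileMap_eq_of_mem_box hys hbox]
  exact ⟨hys, hbox⟩

theorem pi_real_singleton (ξ : Fin m → ℝ) : (Measure.pi μ).real {ξ} = prob μ ξ := by
  rw [measureReal_def, Measure.pi_singleton, ENNReal.toReal_prod]
  rfl

theorem ae_mem_scenarios : ∀ᵐ ξ ∂(Measure.pi μ), ξ ∈ (scenarios μ hfin : Set (Fin m → ℝ)) := by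
  have : ∀ᵐ ξ ∂(Measure.pi μ), ∀ k, ξ k ∈ (μ k).support :=
    eventually_all.2 fun k => Measure.tendsto_eval_ae_ae.eventually Measure.support_mem_ae
  filter_upwards [this] with ξ hξ using mem_scenarios.2 hξ

theorem sum_prob : ∑ ξ ∈ scenarios μ hfin, prob μ ξ = 1 := by
  simp_rw [← pi_real_singleton]
  rw [sum_measureReal_singleton, measureReal_def,
    (mem_ae_iff_prob_eq_one (Finset.measurableSet _)).1 ae_mem_scenarios, ENNReal.toReal_one]

theorem TwoStageLP.objective_eq_sum {p s d : ℕ} (L : TwoStageLP m p s d) (x : Fin p → ℝ) :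
    L.objective μ x = ∑ ξ ∈ scenarios μ hfin, prob μ ξ * L.cost x ξ := by
  unfold TwoStageLP.objective
  rw [← Measure.restrict_eq_self_of_ae_mem (ae_mem_scenarios (hfin := hfin)),
    setIntegral_finset _ IntegrableOn.finset]
  simp_rw [pi_real_singleton, smul_eq_mul]

theorem uniformCube_box_pos {ξ : Fin m → ℝ} (hξ : ξ ∈ scenarios μ hfin) :
    0 < uniformCube m (box μ ξ) := by
  unfold uniformCube box
  rw [Measure.pi_pi]
  refine CanonicallyOrderedAdd.prod_pos.2 fun k _ => ?_
  rw [Measure.restrict_apply measurableSet_Ioc, Set.inter_eq_left.2, Real.volume_Ioc,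
    measureReal_Iic_sub_Iio, ENNReal.ofReal_pos]
  · exact ENNReal.toReal_pos
      (measure_singleton_pos_of_mem_support (hfin k) (mem_scenarios.1 hξ k)).ne' (measure_ne_top _ _)
  · exact Set.Ioc_subset_Ioc measureReal_nonneg measureReal_le_one

/-- An infinite value at one scenario is an infinite value on a box of positive volume, which makes
the second moment infinite. -/
theorem TwoStageLP.extCost_abs_lt_top {p s d : ℕ} {L : TwoStageLP m p s d} {x : Fin p → ℝ}
    (hx : L.secondMoment μ x < ⊤) {ξ : Fin m → ℝ} (hξ : ξ ∈ scenarios μ hfin) :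
    (L.extCost x ξ).abs ≠ ⊤ := by
  intro htop
  refine hx.ne (top_unique ?_)
  calc ⊤ = ∫⁻ _ in box μ ξ, ⊤ ∂(uniformCube m) := by
        rw [setLIntegral_const, ENNReal.top_mul (uniformCube_box_pos hξ).ne']
    _ = ∫⁻ u in box μ ξ, (L.extCost x (quantileMap μ u)).abs ^ 2 ∂(uniformCube m) :=
        setLIntegral_congr_fun (measurableSet_box ξ) fun u hu => by
          simp [quantileMap_eq_of_mem_box hξ hu, htop]
    _ ≤ _ := setLIntegral_le_lintegral _ _

end SAA

/-! ### Chernoff bound and Borel–Cantelli under negative dependence. -/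

namespace SAA

section Concentration

variable {Ω : Type*}

/-- The number of indices `i` such that `ω` belongs to `Z i`. -/
noncomputable def count {n : ℕ} (Z : Fin n → Set Ω) (ω : Ω) : ℕ := {i | ω ∈ Z i}.ncard

theorem prod_one_add_indicator {n : ℕ} (Z : Fin n → Set Ω) (θ : ℝ) (ω : Ω) :
    ∏ i, (1 + (Z i).indicator (fun _ => θ) ω) = (1 + θ) ^ count Z ω := by
  classical
  have : ∀ i, 1 + (Z i).indicator (fun _ => θ) ω = if ω ∈ Z i then 1 + θ else 1 := fun i => by
    by_cases h : ω ∈ Z i <;> simp [h]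
  simp_rw [this]
  rw [Finset.prod_ite, Finset.prod_const, Finset.prod_const_one, mul_one, count,
    Set.ncard_eq_toFinset_card']
  congr 2
  ext i
  simp

theorem prod_indicator {n : ℕ} (Z : Fin n → Set Ω) (θ : ℝ) (A : Finset (Fin n)) (ω : Ω) :
    ∏ i ∈ A, (Z i).indicator (fun _ => θ) ω =
      (⋂ i ∈ A, Z i).indicator (fun _ => θ ^ A.card) ω := by
  classical
  simp_rw [Set.indicator_apply]
  rw [Finset.prod_ite_zero, Finset.prod_const]
  simp

variable [MeasurableSpace Ω] {P : Measure Ω} [IsProbabilityMeasure P]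

/-- Chernoff bound for negatively dependent events. -/
theorem measureReal_count_ge_le {n : ℕ} {Z : Fin n → Set Ω}
    (hZ : ∀ i, NullMeasurableSet (Z i) P) {p ε : ℝ} (hp : 0 ≤ p) (hε : 0 < ε) (hε1 : ε ≤ 1)
    (h : ∀ A : Finset (Fin n), P.real (⋂ i ∈ A, Z i) ≤ p ^ A.card) :
    P.real {ω | (p + ε) * n ≤ count Z ω} ≤ Real.exp (-(ε ^ 2 / (4 * (p + 1)))) ^ n := by
  classical
  -- With `exp c - 1 ≤ c + c ^ 2`, the exponent per row is at most `p * (c + c ^ 2) - c * (p + ε)`.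
  -- This `c` gives `p * c ≤ ε / 2`, so the exponent is at most `-(c * ε / 2)`.
  set c := ε / (2 * (p + 1)) with hc
  have hc0 : 0 < c := by positivity
  have hcp : c * (p + 1) = ε / 2 := by
    rw [hc]
    field_simp
  have hc1 : c ≤ 1 := by
    rw [hc, div_le_one (by positivity)]
    linarith
  set θ := Real.exp c - 1 with hθ
  have hθ0 : 0 ≤ θ := by linarith [Real.add_one_le_exp c]
  have hθ1 : θ ≤ c + c ^ 2 := by
    have := (abs_le.1 (Real.abs_exp_sub_one_sub_id_le (x := c) (by rw [abs_of_pos hc0]; exact hc1))).2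
    linarith
  -- Expanding `(1 + θ) ^ count` over subsets, with `θ ≥ 0`, lets bounds on the intersections
  -- control the moment generating function.
  have hexp : ∀ ω, Real.exp (c * count Z ω) = ∑ A : Finset (Fin n),
      (⋂ i ∈ A, Z i).indicator (fun _ => θ ^ A.card) ω := by
    intro ω
    rw [mul_comm, Real.exp_nat_mul, show Real.exp c = 1 + θ by rw [hθ]; ring,
      ← prod_one_add_indicator, Finset.prod_one_add, Finset.powerset_univ]
    simp_rw [prod_indicator]
  have hmeas : ∀ A : Finset (Fin n), NullMeasurableSet (⋂ i ∈ A, Z i) P := fun A =>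
    A.nullMeasurableSet_biInter fun i _ => hZ i
  have hintA : ∀ A : Finset (Fin n),
      Integrable ((⋂ i ∈ A, Z i).indicator (fun _ => θ ^ A.card)) P := fun A =>
    (integrable_const _).indicator₀ (hmeas A)
  have hint : Integrable (fun ω => Real.exp (c * count Z ω)) P := by
    simp_rw [hexp]
    exact integrable_finsetSum _ fun A _ => hintA A
  have hbound : ∫ ω, Real.exp (c * count Z ω) ∂P ≤ Real.exp (n * (p * (c + c ^ 2))) := by
    calc ∫ ω, Real.exp (c * count Z ω) ∂P
        = ∑ A : Finset (Fin n), P.real (⋂ i ∈ A, Z i) * θ ^ A.card := by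
          simp_rw [hexp]
          rw [integral_finsetSum _ fun A _ => hintA A]
          refine Finset.sum_congr rfl fun A _ => ?_
          rw [integral_indicator₀ (hmeas A), setIntegral_const, smul_eq_mul]
      _ ≤ ∑ A : Finset (Fin n), ∏ _i ∈ A, p * θ := by
          refine Finset.sum_le_sum fun A _ => ?_
          rw [Finset.prod_const, mul_pow]
          exact mul_le_mul_of_nonneg_right (h A) (by positivity)
      _ = (1 + p * θ) ^ n := by
          rw [← Finset.powerset_univ, ← Finset.prod_one_add]
          simp
      _ ≤ Real.exp (p * (c + c ^ 2)) ^ n := by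
          refine pow_le_pow_left₀ (by positivity) ?_ n
          have h1 := Real.add_one_le_exp (p * (c + c ^ 2))
          have h2 := mul_le_mul_of_nonneg_left hθ1 hp
          linarith
      _ = _ := by rw [← Real.exp_nat_mul]
  have hmarkov := mul_meas_ge_le_integral_of_nonneg (μ := P)
    (Eventually.of_forall fun ω => (Real.exp_pos (c * count Z ω)).le) hint
    (Real.exp (c * ((p + ε) * n)))
  have hset : {ω | Real.exp (c * ((p + ε) * n)) ≤ Real.exp (c * count Z ω)} =
      {ω | (p + ε) * n ≤ count Z ω} := by
    ext ω
    simp only [Set.mem_ofPred_eq, Real.exp_le_exp]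
    exact mul_le_mul_iff_right₀ hc0
  rw [hset] at hmarkov
  have := hmarkov.trans hbound
  rw [mul_comm, ← le_div_iff₀ (Real.exp_pos _), ← Real.exp_sub] at this
  refine this.trans ?_
  rw [← Real.exp_nat_mul, Real.exp_le_exp]
  have h4 : ε ^ 2 / (4 * (p + 1)) = c * ε / 2 := by
    rw [hc]
    field_simp
    ring
  rw [h4]
  have h5 : p * (c + c ^ 2) - c * (p + ε) ≤ -(c * ε / 2) := by
    nlinarith [mul_pos hc0 hc0]
  calc n * (p * (c + c ^ 2)) - c * ((p + ε) * n) = n * (p * (c + c ^ 2) - c * (p + ε)) := by ring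
    _ ≤ n * -(c * ε / 2) := mul_le_mul_of_nonneg_left h5 n.cast_nonneg

/-- Almost surely the frequency of asymptotically negatively dependent events is asymptotically at
most their probability. No assumption is made on the dependence between different `n`. -/
theorem ae_eventually_count_le {Z : (n : ℕ) → Fin n → Set Ω}
    (hZ : ∀ n, 1 ≤ n → ∀ i, NullMeasurableSet (Z n i) P) {p : ℝ} (hp : 0 ≤ p)
    (h : ∀ p', p < p' → ∀ᶠ n : ℕ in atTop, ∀ A : Finset (Fin n),
      P.real (⋂ i ∈ A, Z n i) ≤ p' ^ A.card) :
    ∀ᵐ ω ∂P, ∀ ε > 0, ∀ᶠ n : ℕ in atTop, (count (Z n) ω : ℝ) ≤ (p + ε) * n := by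
  have key : ∀ k : ℕ, ∀ᵐ ω ∂P, ∀ᶠ n : ℕ in atTop,
      (count (Z n) ω : ℝ) ≤ (p + 2 * (1 / ((k : ℝ) + 1))) * n := by
    intro k
    set ε : ℝ := 1 / ((k : ℝ) + 1) with hεdef
    have hε : 0 < ε := by positivity
    have hε1 : ε ≤ 1 := by
      rw [hεdef, div_le_one (by positivity)]
      linarith [(k.cast_nonneg : (0 : ℝ) ≤ k)]
    -- One `ε` is spent on the approximate domination, the other on the Chernoff deviation.
    obtain ⟨N, hN⟩ := eventually_atTop.1 ((h (p + ε) (by linarith)).and (eventually_ge_atTop 1))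
    set r := Real.exp (-(ε ^ 2 / (4 * (p + ε + 1)))) with hr
    have hr1 : r < 1 := Real.exp_lt_one_iff.2 (by
      have : 0 < ε ^ 2 / (4 * (p + ε + 1)) := by positivity
      linarith)
    set s : ℕ → Set Ω := fun n => {ω | N ≤ n ∧ (p + ε + ε) * n ≤ count (Z n) ω} with hs
    have hle : ∀ n, P (s n) ≤ ENNReal.ofReal (r ^ n) := by
      intro n
      by_cases hn : N ≤ n
      · have := measureReal_count_ge_le (P := P) (hZ n (hN n hn).2) (p := p + ε) (by linarith)
          hε hε1 (hN n hn).1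
        rw [← ofReal_measureReal]
        refine ENNReal.ofReal_le_ofReal ?_
        simpa [hs, hn] using this
      · simp [hs, hn]
    have hsum : ∑' n, P (s n) ≠ ⊤ := by
      refine ne_top_of_le_ne_top ?_ (ENNReal.tsum_le_tsum hle)
      exact (summable_geometric_of_lt_one (Real.exp_pos _).le hr1).tsum_ofReal_ne_top
    filter_upwards [ae_eventually_notMem hsum] with ω hω
    filter_upwards [hω, eventually_ge_atTop N] with n hn hNn
    simp only [hs, Set.mem_ofPred_eq, not_and, not_le] at hn
    have := hn hNn
    linarith
  filter_upwards [ae_all_iff.2 key] with ω hω ε hε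
  obtain ⟨k, hk⟩ := exists_nat_one_div_lt (half_pos hε)
  filter_upwards [hω k] with n hn
  refine hn.trans (mul_le_mul_of_nonneg_right ?_ n.cast_nonneg)
  linarith

/-- If frequencies sum up to one, then asymptotic upper bounds for them that also sum up to one are
their limits. -/
theorem tendsto_of_eventually_le {α : Type*} {S : Finset α} {f : ℕ → α → ℝ} {p : α → ℝ}
    (hle : ∀ a ∈ S, ∀ ε > 0, ∀ᶠ n in atTop, f n a ≤ p a + ε)
    (hf : ∀ᶠ n in atTop, ∑ a ∈ S, f n a = 1) (hp : ∑ a ∈ S, p a = 1) {a : α} (ha : a ∈ S) :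
    Tendsto (fun n => f n a) atTop (nhds (p a)) := by
  classical
  rw [Metric.tendsto_nhds]
  intro ε hε
  have hcard : (0 : ℝ) < S.card + 1 := by positivity
  -- The lower bound comes from the others: `f n a = 1 - ∑ f n b ≥ p a - S.card * η`, summing over
  -- `b ≠ a`.
  set η := ε / (2 * (S.card + 1)) with hη
  have hη0 : 0 < η := by positivity
  have hηε : (S.card + 1) * η = ε / 2 := by
    rw [hη]
    field_simp
  filter_upwards [hf, (S.eventually_all).2 fun b hb => hle b hb η hη0] with n hn hb
  have h1 := hb a ha
  have h2 : ∑ b ∈ S.erase a, f n b ≤ ∑ b ∈ S.erase a, p b + (S.erase a).card * η := by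
    have := Finset.sum_le_sum fun b hb' => hb b (Finset.mem_of_mem_erase (a := a) hb')
    simpa [Finset.sum_add_distrib] using this
  have h3 := Finset.add_sum_erase S (f n) ha
  have h4 := Finset.add_sum_erase S p ha
  have h5 : ((S.erase a).card : ℝ) * η ≤ S.card * η := by
    refine mul_le_mul_of_nonneg_right ?_ hη0.le
    exact_mod_cast Finset.card_le_card (Finset.erase_subset _ _)
  have h6 : 0 ≤ (S.card : ℝ) * η := by positivity
  rw [Real.dist_eq, abs_lt]
  constructor <;> linarith

end Concentration

end SAA

/-! ### Box domination for the three sampling schemes. -/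

namespace SAA

/-- The rows of the random matrix `X` lie in the unit cube, and the events that rows lie in a given
box are negatively dependent, up to enlarging the sides of the box by `2 / n`. -/
structure BoxDominated {Ω : Type*} [MeasurableSpace Ω] (P : Measure Ω) {n m : ℕ}
    (X : Ω → Fin n → Fin m → ℝ) : Prop where
  aemeasurable : AEMeasurable X P
  ae_mem : ∀ᵐ ω ∂P, ∀ i k, X ω i k ∈ Set.Ioc (0 : ℝ) 1
  le : ∀ a b : Fin m → ℝ, (∀ k, 0 ≤ a k ∧ a k ≤ b k ∧ b k ≤ 1) → ∀ A : Finset (Fin n),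
    P {ω | ∀ i ∈ A, ∀ k, X ω i k ∈ Set.Ioc (a k) (b k)} ≤
      ENNReal.ofReal (∏ k, (b k - a k + 2 / n)) ^ A.card

variable {n m : ℕ}

theorem measurableSet_rows_mem {Γ : Type*} [MeasurableSpace Γ] {X : Γ → Fin n → Fin m → ℝ}
    (hX : Measurable X) (A : Finset (Fin n)) (a b : Fin m → ℝ) :
    MeasurableSet {ω | ∀ i ∈ A, ∀ k, X ω i k ∈ Set.Ioc (a k) (b k)} := by
  have h1 : ∀ i k, Measurable fun ω => X ω i k := fun i k => by fun_prop
  have : {ω | ∀ i ∈ A, ∀ k, X ω i k ∈ Set.Ioc (a k) (b k)} =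
      ⋂ i ∈ A, ⋂ k, (fun ω => X ω i k) ⁻¹' Set.Ioc (a k) (b k) := by
    ext ω
    simp
  rw [this]
  exact A.measurableSet_biInter fun i _ => MeasurableSet.iInter fun k => h1 i k measurableSet_Ioc

theorem measurableSet_mem_unit {Γ : Type*} [MeasurableSpace Γ] {X : Γ → Fin n → Fin m → ℝ}
    (hX : Measurable X) : MeasurableSet {ω | ∀ i k, X ω i k ∈ Set.Ioc (0 : ℝ) 1} := by
  simpa using measurableSet_rows_mem hX Finset.univ (fun _ => 0) (fun _ => 1)

theorem BoxDominated.comp_hasLaw {Ω Γ : Type*} [MeasurableSpace Ω] [MeasurableSpace Γ]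
    {P : Measure Ω} {ν : Measure Γ} {Y : Ω → Γ} (hY : HasLaw Y ν P)
    {X : Γ → Fin n → Fin m → ℝ} (hXm : Measurable X) (hX : BoxDominated ν X) :
    BoxDominated P fun ω => X (Y ω) where
  aemeasurable := hXm.comp_aemeasurable hY.aemeasurable
  ae_mem := by
    have h := hX.ae_mem
    rw [← hY.map_eq] at h
    exact ae_of_ae_map hY.aemeasurable h
  le a b hab A := by
    rw [hY.measure_eq (measurableSet_rows_mem hXm A a b)]
    exact hX.le a b hab A

theorem uniformCube_pi_Ioc {a b : Fin m → ℝ} (hab : ∀ k, 0 ≤ a k ∧ a k ≤ b k ∧ b k ≤ 1) :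
    uniformCube m (Set.univ.pi fun k => Set.Ioc (a k) (b k)) =
      ENNReal.ofReal (∏ k, (b k - a k)) := by
  unfold uniformCube
  rw [Measure.pi_pi, ENNReal.ofReal_prod_of_nonneg fun k _ => sub_nonneg.2 (hab k).2.1]
  refine Finset.prod_congr rfl fun k _ => ?_
  rw [Measure.restrict_apply measurableSet_Ioc,
    Set.inter_eq_left.2 (Set.Ioc_subset_Ioc (hab k).1 (hab k).2.2), Real.volume_Ioc]

instance : IsProbabilityMeasure ((volume : Measure ℝ).restrict (Set.Ioc 0 1)) := ⟨by simp⟩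

instance : IsProbabilityMeasure ((volume : Measure ℝ).restrict (Set.Ico 0 1)) := ⟨by simp⟩

instance : IsProbabilityMeasure (uniformCube m) := by
  unfold uniformCube
  infer_instance

/-- Independence of rows gives the bound without the slack `2 / n`, which is there for the Latin
hypercubes. -/
theorem boxDominated_monteCarlo : BoxDominated (monteCarloLaw n m) (fun D => D) where
  aemeasurable := aemeasurable_id
  ae_mem := by
    refine eventually_all.2 fun i => Measure.tendsto_eval_ae_ae.eventually
      (p := fun u : Fin m → ℝ => ∀ k, u k ∈ Set.Ioc (0 : ℝ) 1) ?_
    exact eventually_all.2 fun k => Measure.tendsto_eval_ae_ae.eventually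
      (ae_restrict_mem measurableSet_Ioc)
  le a b hab A := by
    classical
    have hset : {D : Fin n → Fin m → ℝ | ∀ i ∈ A, ∀ k, D i k ∈ Set.Ioc (a k) (b k)} =
        Set.univ.pi fun i => if i ∈ A then Set.univ.pi fun k => Set.Ioc (a k) (b k)
          else Set.univ := by
      ext D
      simp only [Set.mem_ofPred_eq, Set.mem_pi, Set.mem_univ, true_imp_iff]
      refine forall_congr' fun i => ?_
      by_cases h : i ∈ A <;> simp [h]
    rw [hset, monteCarloLaw, Measure.pi_pi]
    have : ∀ i, uniformCube m (if i ∈ A then Set.univ.pi fun k => Set.Ioc (a k) (b k)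
        else Set.univ) = if i ∈ A then ENNReal.ofReal (∏ k, (b k - a k)) else 1 := fun i => by
      by_cases h : i ∈ A
      · simp only [h, if_true, uniformCube_pi_Ioc hab]
      · simp [h]
    simp_rw [this]
    rw [Finset.prod_ite_mem, Finset.univ_inter, Finset.prod_const]
    refine pow_le_pow_left' (ENNReal.ofReal_le_ofReal ?_) _
    refine Finset.prod_le_prod (fun k _ => sub_nonneg.2 (hab k).2.1) fun k _ => ?_
    have : (0 : ℝ) ≤ 2 / n := by positivity
    linarith

/-- The levels whose cell `(j / n, (j + 1) / n]` meets `(a, b]`. -/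
noncomputable def levels (n : ℕ) (a b : ℝ) : Finset (Fin n) :=
  Finset.univ.filter fun j => a * n < (j : ℕ) + 1 ∧ ((j : ℕ) : ℝ) < b * n

/-- The levels lie between `⌊a * n⌋₊` and `⌈b * n⌉₊ - 1`; each rounding costs at most one. -/
theorem card_levels_le {a b : ℝ} (ha : 0 ≤ a) (hab : a ≤ b) :
    ((levels n a b).card : ℝ) ≤ n * (b - a) + 2 := by
  have hsub : (levels n a b).card ≤ (Finset.Ico ⌊a * n⌋₊ ⌈b * n⌉₊).card := by
    refine Finset.card_le_card_of_injOn (fun j : Fin n => (j : ℕ)) (fun j hj => ?_)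
      (fun i _ j _ h => Fin.ext h)
    have hj' : a * n < (j : ℕ) + 1 ∧ ((j : ℕ) : ℝ) < b * n := by simpa [levels] using hj
    simp only [Finset.coe_Ico, Set.mem_Ico]
    refine ⟨Nat.lt_succ_iff.1 ((Nat.floor_lt (by positivity)).2 ?_), Nat.lt_ceil.2 hj'.2⟩
    push_cast
    exact hj'.1
  have h1 := Nat.lt_floor_add_one (a * (n : ℝ))
  have h2 := Nat.ceil_lt_add_one (a := b * (n : ℝ)) (mul_nonneg (ha.trans hab) n.cast_nonneg)
  have h3 : (⌊a * n⌋₊ : ℝ) ≤ ⌈b * n⌉₊ := by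
    exact_mod_cast (Nat.floor_mono (by gcongr)).trans (Nat.floor_le_ceil _)
  have h4 : ((levels n a b).card : ℝ) ≤ ⌈b * n⌉₊ - ⌊a * n⌋₊ := by
    rw [Nat.card_Ico] at hsub
    rw [← Nat.cast_sub (by exact_mod_cast h3)]
    exact_mod_cast hsub
  linarith

theorem mem_levels_of_mem_Ioc (hn : 1 ≤ n) {a b u : ℝ} {j : Fin n} (hu : u ∈ Set.Ioc a b)
    (hj : u ∈ Set.Ioc (((j : ℕ) : ℝ) / n) ((((j : ℕ) : ℝ) + 1) / n)) : j ∈ levels n a b := by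
  have hn' : (0 : ℝ) < n := by exact_mod_cast hn
  simp only [levels, Finset.mem_filter, Finset.mem_univ, true_and]
  rw [← lt_div_iff₀ hn', ← div_lt_iff₀ hn']
  exact ⟨hu.1.trans_le hj.2, hj.1.trans_le hu.2⟩

/-- Fraction of tuples of column permutations which put all rows in `A` in given levels. -/
theorem card_perm_tuple_le (hn : 1 ≤ n) (J : Fin m → Finset (Fin n)) {w : Fin m → ℝ}
    (hJ : ∀ k, ((J k).card : ℝ) ≤ n * w k) (A : Finset (Fin n)) :
    ((Finset.univ.filter fun π : Fin m → Equiv.Perm (Fin n) =>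
        ∀ k, ∀ i ∈ A, π k i ∈ J k).card : ℝ) ≤
      (∏ k, w k) ^ A.card * Fintype.card (Fin m → Equiv.Perm (Fin n)) := by
  have hn' : (0 : ℝ) < n := by exact_mod_cast hn
  have hset : (Finset.univ.filter fun π : Fin m → Equiv.Perm (Fin n) =>
      ∀ k, ∀ i ∈ A, π k i ∈ J k) =
      Fintype.piFinset fun k => Finset.univ.filter fun π : Equiv.Perm (Fin n) =>
        ∀ i ∈ A, π i ∈ J k := by
    ext π
    simp [Fintype.mem_piFinset]
  rw [hset, Fintype.card_piFinset, Fintype.card_pi, Nat.cast_prod, Nat.cast_prod,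
    ← Finset.prod_pow, ← Finset.prod_mul_distrib]
  refine Finset.prod_le_prod (fun _ _ => Nat.cast_nonneg _) fun k _ => ?_
  have h1 : ((Finset.univ.filter fun π : Equiv.Perm (Fin n) => ∀ i ∈ A, π i ∈ J k).card : ℝ) *
      (n : ℝ) ^ A.card ≤ ((J k).card : ℝ) ^ A.card * Fintype.card (Equiv.Perm (Fin n)) := by
    have := card_perm_mapsTo_le (J k) A
    rw [Fintype.card_fin] at this
    rw [← Nat.cast_pow, ← Nat.cast_pow, ← Nat.cast_mul, ← Nat.cast_mul, Nat.cast_le]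
    convert this
  have h2 : ((J k).card : ℝ) ^ A.card ≤ (n : ℝ) ^ A.card * w k ^ A.card := by
    rw [← mul_pow]
    exact pow_le_pow_left₀ (Nat.cast_nonneg _) (hJ k) _
  refine le_of_mul_le_mul_right ?_ (pow_pos hn' A.card)
  calc _ ≤ ((J k).card : ℝ) ^ A.card * Fintype.card (Equiv.Perm (Fin n)) := h1
    _ ≤ (n : ℝ) ^ A.card * w k ^ A.card * Fintype.card (Equiv.Perm (Fin n)) := by gcongr
    _ = _ := by ring

theorem card_filter_fst {α β κ : Type*} [Fintype α] [Fintype β] [Fintype κ] (e : κ ≃ α × β)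
    (p : α → Prop) [DecidablePred p] :
    (Finset.univ.filter fun x : κ => p (e x).1).card =
      (Finset.univ.filter p).card * Fintype.card β := by
  classical
  rw [← Finset.card_univ (α := β), ← Finset.card_product]
  refine Finset.card_equiv e fun x => ?_
  simp

/-- An equal-weight mixture over tuples of column permutations, and possibly more, of matrices whose
entries lie in the cells selected by the permutations. -/
theorem boxDominated_mixture (hn : 1 ≤ n) {κ β Γ 𝓧 : Type*} [Fintype κ] [Fintype β] [Nonempty κ]
    [MeasurableSpace Γ] [MeasurableSpace 𝓧] (e : κ ≃ (Fin m → Equiv.Perm (Fin n)) × β)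
    (ρ : Measure Γ) [IsProbabilityMeasure ρ] (g : κ → Γ → 𝓧) (hg : ∀ x, Measurable (g x))
    (X : 𝓧 → Fin n → Fin m → ℝ) (hX : Measurable X)
    (hcell : ∀ x, ∀ᵐ γ ∂ρ, ∀ i k, X (g x γ) i k ∈
      Set.Ioc ((((e x).1 k i : ℕ) : ℝ) / n) (((((e x).1 k i : ℕ) : ℝ) + 1) / n)) :
    BoxDominated ((Fintype.card κ : ENNReal)⁻¹ • ∑ x, ρ.map (g x)) X := by
  have hn' : (0 : ℝ) < n := by exact_mod_cast hn
  have happly : ∀ S : Set 𝓧, MeasurableSet S →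
      ((Fintype.card κ : ENNReal)⁻¹ • ∑ x, ρ.map (g x)) S =
        (Fintype.card κ : ENNReal)⁻¹ * ∑ x, ρ (g x ⁻¹' S) := by
    intro S hS
    rw [Measure.smul_apply, Measure.finsetSum_apply, smul_eq_mul]
    simp_rw [Measure.map_apply (hg _) hS]
  refine ⟨hX.aemeasurable, ?_, fun a b hab A => ?_⟩
  · rw [ae_iff]
    have hm := (measurableSet_mem_unit hX).compl
    change _ = _
    refine (happly _ hm).trans ?_
    refine mul_eq_zero_of_right _ (Finset.sum_eq_zero fun x _ => ?_)
    refine measure_eq_zero_iff_ae_notMem.2 ?_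
    filter_upwards [hcell x] with γ hγ
    simp only [Set.mem_preimage, Set.mem_compl_iff, not_not]
    intro i k
    refine ⟨(by positivity : (0 : ℝ) ≤ _).trans_lt (hγ i k).1, (hγ i k).2.trans ?_⟩
    rw [div_le_one hn']
    exact_mod_cast ((e x).1 k i).2
  · rw [happly _ (measurableSet_rows_mem hX A a b)]
    set p : (Fin m → Equiv.Perm (Fin n)) → Prop := fun π =>
      ∀ k, ∀ i ∈ A, π k i ∈ levels n (a k) (b k) with hp
    let _ : DecidablePred p := fun π => inferInstanceAs
      (Decidable (∀ k, ∀ i ∈ A, π k i ∈ levels n (a k) (b k)))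
    -- A mixture component contributes at most one, and nothing unless its permutations send the
    -- rows of `A` to levels meeting the box.
    have h1 : ∑ x, ρ (g x ⁻¹' {y | ∀ i ∈ A, ∀ k, X y i k ∈ Set.Ioc (a k) (b k)}) ≤
        ((Finset.univ.filter fun x => p (e x).1).card : ENNReal) := by
      rw [Finset.card_filter, Nat.cast_sum]
      refine Finset.sum_le_sum fun x _ => ?_
      by_cases hx : p (e x).1
      · simpa [hx] using prob_le_one
      · simp only [hx, if_false, Nat.cast_zero, nonpos_iff_eq_zero]
        refine measure_eq_zero_iff_ae_notMem.2 ?_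
        filter_upwards [hcell x] with γ hγ hmem
        exact hx fun k i hi => mem_levels_of_mem_Ioc hn (hmem i hi k) (hγ i k)
    have h2 := card_perm_tuple_le hn (fun k => levels n (a k) (b k))
      (w := fun k => b k - a k + 2 / n) (fun k => by
        refine (card_levels_le (hab k).1 (hab k).2.1).trans_eq ?_
        field_simp) A
    have hw : 0 ≤ ∏ k, (b k - a k + 2 / (n : ℝ)) := Finset.prod_nonneg fun k _ => by
      have : (0 : ℝ) ≤ 2 / n := by positivity
      linarith [(hab k).2.1]
    have h3 : ((Finset.univ.filter fun x => p (e x).1).card : ℝ) ≤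
        (∏ k, (b k - a k + 2 / (n : ℝ))) ^ A.card * Fintype.card κ := by
      rw [card_filter_fst e p, Fintype.card_congr e, Fintype.card_prod, Nat.cast_mul, Nat.cast_mul,
        ← mul_assoc]
      exact mul_le_mul_of_nonneg_right h2 (Nat.cast_nonneg _)
    have h4 : ((Finset.univ.filter fun x => p (e x).1).card : ENNReal) ≤
        ENNReal.ofReal (∏ k, (b k - a k + 2 / (n : ℝ))) ^ A.card * Fintype.card κ := by
      rw [← ENNReal.ofReal_natCast, ← ENNReal.ofReal_natCast, ← ENNReal.ofReal_pow hw,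
        ← ENNReal.ofReal_mul (pow_nonneg hw _)]
      exact ENNReal.ofReal_le_ofReal h3
    rw [mul_comm, ← div_eq_mul_inv]
    exact ENNReal.div_le_of_le_mul (h1.trans h4)

theorem boxDominated_latinHypercube (hn : 1 ≤ n) :
    BoxDominated (latinHypercubeLaw n m) (fun D => D) := by
  have hn' : (0 : ℝ) < n := by exact_mod_cast hn
  refine boxDominated_mixture hn (Equiv.prodPUnit.{0} _).symm _ _ (fun π => ?_) _ measurable_id
    fun π => ?_
  · fun_prop
  · have h : ∀ᵐ γ ∂(Measure.pi fun _ : Fin n => Measure.pi fun _ : Fin m =>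
        (volume : Measure ℝ).restrict (Set.Ico (0 : ℝ) 1)), ∀ i k, γ i k ∈ Set.Ico (0 : ℝ) 1 :=
      eventually_all.2 fun i => Measure.tendsto_eval_ae_ae.eventually
        (p := fun u : Fin m → ℝ => ∀ k, u k ∈ Set.Ico (0 : ℝ) 1) <|
        eventually_all.2 fun k => Measure.tendsto_eval_ae_ae.eventually
          (ae_restrict_mem measurableSet_Ico)
    filter_upwards [h] with γ hγ i k
    have := hγ i k
    simp only [Equiv.prodPUnit_symm_apply, Set.mem_Ioc]
    constructor
    · gcongr
      linarith [this.2]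
    · gcongr
      linarith [this.1]

/-- A single batch is dominated like an ordinary Latin hypercube: the block of level `ℓ` rescales
into the cell `(ℓ / n, (ℓ + 1) / n]`, whatever `σ` and the other batches are. Those form the extra
factor of the mixture. -/
theorem boxDominated_slicedLatinHypercube (hn : 1 ≤ n) {t : ℕ} (ht : 1 ≤ t) (r : Fin t) :
    BoxDominated (slicedLatinHypercubeLaw n t m) (fun D => D r) := by
  have hn' : (0 : ℝ) < n := by exact_mod_cast hn
  have ht' : (0 : ℝ) < t := by exact_mod_cast ht
  refine boxDominated_mixture hn (((Equiv.funSplitAt r _).prodCongr (Equiv.refl _)).trans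
    (Equiv.prodAssoc _ _ _)) _ _ (fun π => ?_) _ (by fun_prop) fun Aσ => ?_
  · fun_prop
  · have h : ∀ᵐ γ ∂(Measure.pi fun _ : Fin t => Measure.pi fun _ : Fin n =>
        Measure.pi fun _ : Fin m => (volume : Measure ℝ).restrict (Set.Ico (0 : ℝ) 1)),
        ∀ i k, γ r i k ∈ Set.Ico (0 : ℝ) 1 :=
      Measure.tendsto_eval_ae_ae.eventually
        (p := fun v : Fin n → Fin m → ℝ => ∀ i k, v i k ∈ Set.Ico (0 : ℝ) 1) <|
        eventually_all.2 fun i => Measure.tendsto_eval_ae_ae.eventually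
          (p := fun u : Fin m → ℝ => ∀ k, u k ∈ Set.Ico (0 : ℝ) 1) <|
          eventually_all.2 fun k => Measure.tendsto_eval_ae_ae.eventually
            (ae_restrict_mem measurableSet_Ico)
    filter_upwards [h] with γ hγ i k
    have hγ' := hγ i k
    change _ ∈ Set.Ioc (((Aσ.1 r k i : ℕ) : ℝ) / n) ((((Aσ.1 r k i : ℕ) : ℝ) + 1) / n)
    have hσ : (((Aσ.2 k (Aσ.1 r k i) r : ℕ) : ℝ)) + 1 ≤ t := by
      exact_mod_cast (Aσ.2 k (Aσ.1 r k i) r).2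
    have hσ0 : (0 : ℝ) ≤ ((Aσ.2 k (Aσ.1 r k i) r : ℕ) : ℝ) := Nat.cast_nonneg _
    constructor
    · rw [div_lt_div_iff₀ hn' (by positivity)]
      nlinarith [hγ'.2]
    · rw [div_le_div_iff₀ (by positivity) hn']
      nlinarith [hγ'.1]

theorem IsSampling.boxDominated {Ω : Type*} [MeasurableSpace Ω] {P : Measure Ω} (hn : 1 ≤ n)
    {t : ℕ} (ht : 1 ≤ t) {D : Ω → Fin t → Fin n → Fin m → ℝ} (hD : IsSampling P D) (r : Fin t) :
    BoxDominated P fun ω => D ω r := by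
  rcases hD with h | h | h
  · exact boxDominated_monteCarlo.comp_hasLaw (h r) measurable_id
  · exact (boxDominated_latinHypercube hn).comp_hasLaw (h r) measurable_id
  · exact (boxDominated_slicedLatinHypercube hn ht r).comp_hasLaw h (by fun_prop)

end SAA

/-! ### Convergence of scenario frequencies. -/

namespace SAA

section Frequencies

variable {m : ℕ} (μ : Fin m → Measure ℝ)

open Classical in
/-- The frequency of the scenario `ξ` among the rows of the design `D`. -/
noncomputable def freq {n : ℕ} (D : Fin n → Fin m → ℝ) (ξ : Fin m → ℝ) : ℝ :=
  (n : ℝ)⁻¹ * (Finset.univ.filter fun i => quantileMap μ (D i) = ξ).card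

variable {μ}

theorem freq_nonneg {n : ℕ} (D : Fin n → Fin m → ℝ) (ξ : Fin m → ℝ) : 0 ≤ freq μ D ξ := by
  unfold freq
  positivity

theorem mean_comp_quantileMap_eq_sum {n : ℕ} {D : Fin n → Fin m → ℝ} {S : Finset (Fin m → ℝ)}
    (hS : ∀ i, quantileMap μ (D i) ∈ S) (φ : (Fin m → ℝ) → ℝ) :
    (n : ℝ)⁻¹ * ∑ i, φ (quantileMap μ (D i)) = ∑ ξ ∈ S, freq μ D ξ * φ ξ := by
  classical
  rw [← Finset.sum_fiberwise_of_maps_to' (t := S) (g := fun i => quantileMap μ (D i))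
    (fun i _ => hS i), Finset.mul_sum]
  refine Finset.sum_congr rfl fun ξ _ => ?_
  rw [Finset.sum_const, nsmul_eq_mul, freq, mul_assoc]

variable {hfin : ∀ k, (μ k).support.Finite} [hprob : ∀ k, IsProbabilityMeasure (μ k)]
  {Ω : Type*} [MeasurableSpace Ω] {P : Measure Ω} [IsProbabilityMeasure P]

/-- The sides of the box are the atoms `(μ k).real {ξ k}`. As `2 / n` vanishes, the enlarged volume
drops below any `p' > prob μ ξ`. -/
theorem ae_eventually_count_box_le {X : (n : ℕ) → Ω → Fin n → Fin m → ℝ}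
    (hX : ∀ n, 1 ≤ n → BoxDominated P (X n)) (ξ : Fin m → ℝ) :
    ∀ᵐ ω ∂P, ∀ ε > 0, ∀ᶠ n : ℕ in atTop,
      (count (fun i => {ω | X n ω i ∈ box μ ξ}) ω : ℝ) ≤ (prob μ ξ + ε) * n := by
  refine ae_eventually_count_le (fun n hn i => ?_)
    (Finset.prod_nonneg fun k _ => measureReal_nonneg) fun p' hp' => ?_
  · exact ((measurable_pi_apply i).comp_aemeasurable (hX n hn).aemeasurable).nullMeasurable
      (measurableSet_box ξ)
  · set w : ℕ → ℝ := fun n => ∏ k, ((μ k).real (Set.Iic (ξ k)) - (μ k).real (Set.Iio (ξ k)) +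
      2 / (n : ℝ)) with hw
    have hlim : Tendsto w atTop (nhds (prob μ ξ)) := by
      have h : ∀ k, Tendsto (fun n : ℕ => (μ k).real (Set.Iic (ξ k)) -
          (μ k).real (Set.Iio (ξ k)) + 2 / (n : ℝ)) atTop (nhds ((μ k).real {ξ k})) := fun k => by
        rw [measureReal_Iic_sub_Iio]
        simpa using (tendsto_const_div_atTop_nhds_zero_nat (2 : ℝ)).const_add ((μ k).real {ξ k})
      exact tendsto_finsetProd _ fun k _ => h k
    filter_upwards [hlim.eventually_lt_const hp', eventually_ge_atTop 1] with n hn hn1 A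
    have hw0 : 0 ≤ w n := Finset.prod_nonneg fun k _ => by
      rw [measureReal_Iic_sub_Iio]
      positivity
    have hle := (hX n hn1).le (fun k => (μ k).real (Set.Iio (ξ k)))
      (fun k => (μ k).real (Set.Iic (ξ k))) (fun k => ⟨measureReal_nonneg,
        measureReal_mono Set.Iio_subset_Iic_self, measureReal_le_one⟩) A
    have hset : (⋂ i ∈ A, {ω | X n ω i ∈ box μ ξ}) = {ω | ∀ i ∈ A, ∀ k, X n ω i k ∈
        Set.Ioc ((μ k).real (Set.Iio (ξ k))) ((μ k).real (Set.Iic (ξ k)))} := by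
      ext ω
      simp [box, Set.mem_pi]
    rw [hset]
    refine le_trans ?_ (pow_le_pow_left₀ hw0 hn.le A.card)
    rw [← ENNReal.ofReal_pow hw0] at hle
    exact ENNReal.toReal_le_of_le_ofReal (pow_nonneg hw0 _) hle

/-- Strong law of large numbers for the scenario frequencies. -/
theorem ae_tendsto_freq {X : (n : ℕ) → Ω → Fin n → Fin m → ℝ}
    (hX : ∀ n, 1 ≤ n → BoxDominated P (X n)) :
    ∀ᵐ ω ∂P, (∀ᶠ n in atTop, ∀ i, quantileMap μ (X n ω i) ∈ scenarios μ hfin) ∧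
      ∀ ξ ∈ scenarios μ hfin, Tendsto (fun n => freq μ (X n ω) ξ) atTop (nhds (prob μ ξ)) := by
  classical
  have hmem : ∀ᵐ ω ∂P, ∀ n, 1 ≤ n → ∀ i k, X n ω i k ∈ Set.Ioc (0 : ℝ) 1 := by
    refine ae_all_iff.2 fun n => ?_
    by_cases hn : 1 ≤ n
    · filter_upwards [(hX n hn).ae_mem] with ω hω _ using hω
    · exact Eventually.of_forall fun ω h => absurd h hn
  have hcount : ∀ᵐ ω ∂P, ∀ ξ ∈ scenarios μ hfin, ∀ ε > 0, ∀ᶠ n : ℕ in atTop,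
      (count (fun i => {ω | X n ω i ∈ box μ ξ}) ω : ℝ) ≤ (prob μ ξ + ε) * n :=
    (scenarios μ hfin).eventually_all.2 fun ξ _ => ae_eventually_count_box_le hX ξ
  filter_upwards [hmem, hcount] with ω hω hc
  have hS : ∀ n, 1 ≤ n → ∀ i, quantileMap μ (X n ω i) ∈ scenarios μ hfin := fun n hn i =>
    (quantileMap_mem (hω n hn i)).1
  refine ⟨(eventually_ge_atTop 1).mono hS, fun ξ hξ => ?_⟩
  -- Upper bounds suffice, since both frequencies and probabilities sum to one over the scenarios.
  refine tendsto_of_eventually_le (S := scenarios μ hfin) (fun ξ hξ ε hε => ?_) ?_ sum_prob hξ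
  · filter_upwards [hc ξ hξ ε hε, eventually_ge_atTop 1] with n hn hn1
    have hn' : (0 : ℝ) < n := by exact_mod_cast hn1
    have hle : (Finset.univ.filter fun i => quantileMap μ (X n ω i) = ξ).card ≤
        count (fun i => {ω | X n ω i ∈ box μ ξ}) ω := by
      rw [count, ← Set.ncard_coe_finset]
      refine Set.ncard_le_ncard (fun i hi => ?_) (Set.toFinite _)
      have hi' : quantileMap μ (X n ω i) = ξ := by simpa using hi
      have := (quantileMap_mem (hfin := hfin) (hω n hn1 i)).2
      rwa [hi'] at this
    rw [freq, inv_mul_le_iff₀ hn', mul_comm]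
    exact (Nat.cast_le.2 hle).trans hn
  · filter_upwards [eventually_ge_atTop 1] with n hn1
    have hn' : (n : ℝ) ≠ 0 := by
      have : n ≠ 0 := by omega
      exact_mod_cast this
    have := mean_comp_quantileMap_eq_sum (hS n hn1) fun _ => 1
    simp only [mul_one, Finset.sum_const, Finset.card_univ, Fintype.card_fin, nsmul_eq_mul] at this
    rw [← this, inv_mul_cancel₀ hn']

end Frequencies

/-! ### Optimality of the true solution for large samples. -/

namespace TwoStageLP

variable {m p s d : ℕ} {L : TwoStageLP m p s d} {μ : Fin m → Measure ℝ}

/-- If scenario frequencies converge to the scenario probabilities, then the unique optimal solution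
of the true problem is eventually optimal for the sample-average problem. -/
theorem eventually_optimal [hprob : ∀ k, IsProbabilityMeasure (μ k)]
    (hXcompact : IsCompact L.X) (hXpoly : IsPolyhedron L.X)
    {hfin : ∀ k, (μ k).support.Finite} (hmoment : ∀ x ∈ L.X, L.secondMoment μ x < ⊤)
    {xstar : Fin p → ℝ} (hunique : L.optimalSet μ = {xstar})
    {D : (n : ℕ) → Fin n → Fin m → ℝ}
    (hmem : ∀ᶠ n in atTop, ∀ i, quantileMap μ (D n i) ∈ scenarios μ hfin)
    (hlim : ∀ ξ ∈ scenarios μ hfin, Tendsto (fun n => freq μ (D n) ξ) atTop (nhds (prob μ ξ))) :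
    ∀ᶠ n in atTop, L.saaValue μ (D n) = (n : ℝ)⁻¹ * ∑ i, L.costTilde μ xstar (D n i) := by
  have hstar : xstar ∈ L.optimalSet μ := by rw [hunique]; rfl
  have habs : ∀ x ∈ L.X, ∀ ξ ∈ scenarios μ hfin, (L.extCost x ξ).abs ≠ ⊤ := fun x hx ξ hξ =>
    extCost_abs_lt_top (hmoment x hx) hξ
  -- `V` is fixed before `n` and the design, so only finitely many comparisons with `xstar` have to
  -- hold eventually.
  obtain ⟨V, hVfin, hVX, hV⟩ := exists_finite_minimizing_set hXcompact hXpoly ⟨xstar, hstar.1⟩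
    (scenarios μ hfin) (fun x hx ξ hξ h => habs x hx ξ hξ (by rw [h, EReal.abs_bot]))
    (fun x hx ξ hξ h => habs x hx ξ hξ (by rw [h, EReal.abs_top]))
  have hconv : ∀ x, Tendsto (fun n => ∑ ξ ∈ scenarios μ hfin, freq μ (D n) ξ * L.cost x ξ) atTop
      (nhds (L.objective μ x)) := fun x => by
    rw [objective_eq_sum (hfin := hfin)]
    exact tendsto_finsetSum _ fun ξ hξ => (hlim ξ hξ).mul_const _
  have hVle : ∀ᶠ n in atTop, ∀ v ∈ V,
      ∑ ξ ∈ scenarios μ hfin, freq μ (D n) ξ * L.cost xstar ξ ≤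
        ∑ ξ ∈ scenarios μ hfin, freq μ (D n) ξ * L.cost v ξ := by
    refine hVfin.eventually_all.2 fun v hv => ?_
    by_cases hvx : v = xstar
    · exact Eventually.of_forall fun n => by rw [hvx]
    have hlt : L.objective μ xstar < L.objective μ v := by
      by_contra! hle
      have : v ∈ L.optimalSet μ := ⟨hVX hv, fun y hy => hle.trans (hstar.2 y hy)⟩
      rw [hunique] at this
      exact hvx this
    exact ((hconv xstar).eventually_lt (hconv v) hlt).mono fun n hn => hn.le
  filter_upwards [hmem, hVle] with n hn hle
  have hval : ∀ x, (n : ℝ)⁻¹ * ∑ i, L.costTilde μ x (D n i) =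
      ∑ ξ ∈ scenarios μ hfin, freq μ (D n) ξ * L.cost x ξ := fun x =>
    mean_comp_quantileMap_eq_sum hn (L.cost x)
  refine IsLeast.csInf_eq ⟨⟨xstar, hstar.1, rfl⟩, ?_⟩
  rintro _ ⟨x, hx, rfl⟩
  obtain ⟨v, hv, hvle⟩ := hV (freq μ (D n)) (freq_nonneg (D n)) x hx
  simp only [hval]
  exact (hle v hv).trans hvle

end TwoStageLP

end SAA

theorem mainTheorem8 {m p s d : ℕ} (L : SAA.TwoStageLP m p s d)
    (hXcompact : IsCompact L.X) (hXpoly : SAA.IsPolyhedron L.X)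
    (μ : Fin m → Measure ℝ) (hμprob : ∀ k, IsProbabilityMeasure (μ k))
    (hμfin : ∀ k, (μ k).support.Finite)
    (hmoment : ∀ x ∈ L.X, L.secondMoment μ x < ⊤)
    (xstar : Fin p → ℝ) (hunique : L.optimalSet μ = {xstar})
    (t : ℕ) (ht : 1 ≤ t)
    {Ω : Type*} [MeasurableSpace Ω] (P : Measure Ω) (hP : IsProbabilityMeasure P)
    (D : (n : ℕ) → Ω → Fin t → Fin n → Fin m → ℝ)
    (hD : ∀ n, 1 ≤ n → SAA.IsSampling P (D n)) :
    ∀ᵐ ω ∂P, ∀ᶠ n : ℕ in atTop,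
      L.lowerBound μ (D n ω) =
        ((n : ℝ) * (t : ℝ))⁻¹ * ∑ r, ∑ i, L.costTilde μ xstar (D n ω r i) := by
  have hfreq := fun r : Fin t => SAA.ae_tendsto_freq (μ := μ) (hfin := hμfin) (P := P)
    (X := fun n ω => D n ω r) fun n hn => (hD n hn).boxDominated hn ht r
  filter_upwards [ae_all_iff.2 hfreq] with ω hω
  -- Each batch is treated separately; with only `t` batches, the exceptional null sets and the
  -- thresholds in `n` combine.
  have hopt := fun r : Fin t => SAA.TwoStageLP.eventually_optimal hXcompact hXpoly hmoment hunique
    (hω r).1 (hω r).2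
  filter_upwards [eventually_all.2 hopt] with n hn
  simp only [SAA.TwoStageLP.lowerBound, hn]
  rw [← Finset.mul_sum, mul_inv, div_eq_mul_inv]
  ring
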